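/- For an integer $m$ let $p(m)$ denote the number of partitions of $m$, with $p(0)=1$ and $p(m)=0$ for $m<0$. The crank of a partition is its largest part if the partition has no part equal to $1$ (and $0$ for the empty partition of $0$); otherwise it is the number of parts larger than $\omega$, minus $\omega$, where $\omega\ge 1$ is the number of parts equal to $1$. Let $C(n)$ be the number of partitions of $n$ with non-negative crank. Then for all integers $n\ge 0$ and $k\ge 1$, $$(-1)^{k-1}\left(\sum_{j=0}^{k-1}(-1)^j\,p\!\left(n-\frac{j(j+1)}{2}\right)-C(n)\right)\ \ge\ 0,$$ and the inequality is strict if $n\ge \frac{k(k+1)}{2}$. -/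

import Mathlib

/-- Euler's partition function, extended to the integers by `p(m) = 0` for `m < 0`. -/
def partitionFunction (m : ℤ) : ℕ :=
  if 0 ≤ m then Fintype.card (Nat.Partition m.toNat) else 0

namespace Nat.Partition

/-- The number of parts equal to one. -/
def numOnes {n : ℕ} (π : Nat.Partition n) : ℕ :=
  π.parts.count 1

/-- The largest part; it is `0` for the empty partition of `0`. -/
def largestPart {n : ℕ} (π : Nat.Partition n) : ℕ :=
  π.parts.sup

/-- The number of parts that are larger than the number of ones. -/
def numPartsGtOnes {n : ℕ} (π : Nat.Partition n) : ℕ :=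
  π.parts.countP (fun a => π.numOnes < a)

/-- The Andrews–Garvan crank: the largest part if there are no ones, and otherwise the number of
parts larger than the number of ones, minus the number of ones. -/
def crank {n : ℕ} (π : Nat.Partition n) : ℤ :=
  if π.numOnes = 0 then (π.largestPart : ℤ)
  else (π.numPartsGtOnes : ℤ) - (π.numOnes : ℤ)

end Nat.Partition

/-- `C(n)`, the number of partitions of `n` with non-negative crank. -/
def nonnegCrankCount (n : ℕ) : ℕ :=
  Fintype.card {π : Nat.Partition n // 0 ≤ π.crank}

/-! Write `P` for the partition generating function, `B_k` for that of parts at most `k`, and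
`D_{a,m}` for the limit of `durfeeSum a m M`. Two recurrences give `D_{0,m} = D_{1,m} + X^(m+1)
D_{1,m+1} = D_{0,m+1}`. Letting `m` grow shows that each `D_{0,m}` is `P`, hence `D_{1,m} = P -
X^(m+1) D_{1,m+1}`. Iterating `k` times from `m = 0` produces the alternating sum, with error
`X^(k(k+1)/2) D_{1,k}` up to sign (`X_pow_dvd_sum_triangular_sub`).

It remains to see that `D_{1,0}` generates `C(n)`. Counting negative cranks by the number of ones
and the number of larger parts gives a double sum that telescopes to `P - D_{1,0}`
(`sum_sum_sumGenFun_crankClass`). The error term has positive coefficients from degree `k(k+1)/2`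
on, and none below. Limits are replaced by congruences modulo `X ^ M`, used with `M = n + 1`. -/

open PowerSeries

/-! ### Generating functions of families of multisets -/

/-- The generating function, by sum of elements, of a family of multisets of natural numbers. -/
noncomputable def sumGenFun (S : Set (Multiset ℕ)) : PowerSeries ℤ :=
  PowerSeries.mk fun n => (Set.ncard {s | s ∈ S ∧ s.sum = n} : ℤ)

theorem coeff_sumGenFun (S : Set (Multiset ℕ)) (n : ℕ) :
    coeff n (sumGenFun S) = (Set.ncard {s | s ∈ S ∧ s.sum = n} : ℤ) := by
  simp [sumGenFun]

theorem sumGenFun_union {S T : Set (Multiset ℕ)} (hST : Disjoint S T)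
    (hS : ∀ n, {s | s ∈ S ∧ s.sum = n}.Finite) (hT : ∀ n, {s | s ∈ T ∧ s.sum = n}.Finite) :
    sumGenFun (S ∪ T) = sumGenFun S + sumGenFun T := by
  ext n
  rw [map_add, coeff_sumGenFun, coeff_sumGenFun, coeff_sumGenFun, ← Nat.cast_add,
    ← Set.ncard_union_eq _ (hS n) (hT n)]
  · congr 2
    ext s
    simp only [Set.mem_union, Set.mem_ofPred_eq]
    tauto
  · exact hST.mono (fun s hs => hs.1) (fun s hs => hs.1)

theorem sumGenFun_singleton_zero : sumGenFun {0} = 1 := by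
  ext n
  rw [coeff_sumGenFun, coeff_one]
  split_ifs with h
  · subst h
    have : {s : Multiset ℕ | s ∈ ({0} : Set (Multiset ℕ)) ∧ s.sum = 0} = {0} := by
      ext s
      simp only [Set.mem_singleton_iff, Set.mem_ofPred_eq, and_iff_left_iff_imp]
      rintro rfl
      simp
    rw [this, Set.ncard_singleton, Nat.cast_one]
  · have : {s : Multiset ℕ | s ∈ ({0} : Set (Multiset ℕ)) ∧ s.sum = n} = ∅ := by
      ext s
      simp only [Set.mem_singleton_iff, Set.mem_ofPred_eq, Set.mem_empty_iff_false, iff_false]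
      rintro ⟨rfl, hs⟩
      exact h (by simpa using hs.symm)
    rw [this, Set.ncard_empty, Nat.cast_zero]

/-- Product rule for a bijection that shifts the total sum by `c`. Finiteness is assumed because
families containing zeros need not have finite fibres. -/
theorem sumGenFun_eq_mul {S T V : Set (Multiset ℕ)} {f : Multiset ℕ × Multiset ℕ → Multiset ℕ}
    {c : ℕ} (hf : Set.BijOn f (S ×ˢ T) V)
    (hc : ∀ s ∈ S, ∀ t ∈ T, (f (s, t)).sum = s.sum + t.sum + c)
    (hS : ∀ n, {s | s ∈ S ∧ s.sum = n}.Finite) (hT : ∀ n, {s | s ∈ T ∧ s.sum = n}.Finite) :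
    sumGenFun V = X ^ c * (sumGenFun S * sumGenFun T) := by
  ext n
  rw [coeff_X_pow_mul', coeff_sumGenFun]
  split_ifs with hn
  · rw [coeff_mul]
    simp only [coeff_sumGenFun]
    rw [← Finset.sum_coe_sort]
    simp only [← Nat.cast_mul]
    rw [← Nat.cast_sum]
    congr 1
    simp only [← Nat.card_coe_set_eq, ← Nat.card_prod]
    have hS' : ∀ n, Finite {s | s ∈ S ∧ s.sum = n} := hS
    have hT' : ∀ n, Finite {s | s ∈ T ∧ s.sum = n} := hT
    rw [← Nat.card_sigma]
    symm
    refine Nat.card_congr (Equiv.ofBijective (fun x => ⟨f (x.2.1.1, x.2.2.1), ?_, ?_⟩) ⟨?_, ?_⟩)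
    · exact hf.mapsTo ⟨x.2.1.2.1, x.2.2.2.1⟩
    · have h := Finset.HasAntidiagonal.mem_antidiagonal.1 x.1.2
      rw [hc _ x.2.1.2.1 _ x.2.2.2.1, x.2.1.2.2, x.2.2.2.2]
      omega
    · rintro ⟨⟨⟨a, b⟩, hp⟩, ⟨s, hs, hsa⟩, ⟨t, ht, htb⟩⟩
        ⟨⟨⟨a', b'⟩, hp'⟩, ⟨s', hs', hsa'⟩, ⟨t', ht', htb'⟩⟩ h
      obtain rfl : s.sum = a := hsa
      obtain rfl : t.sum = b := htb
      obtain rfl : s'.sum = a' := hsa'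
      obtain rfl : t'.sum = b' := htb'
      have := hf.injOn (x₁ := (s, t)) (x₂ := (s', t')) ⟨hs, ht⟩ ⟨hs', ht'⟩ (by simpa using h)
      simp only [Prod.mk.injEq] at this
      obtain ⟨rfl, rfl⟩ := this
      rfl
    · rintro ⟨v, hv, hvn⟩
      obtain ⟨⟨s, t⟩, ⟨hs, ht⟩, rfl⟩ := hf.surjOn hv
      have := hc s hs t ht
      exact ⟨⟨⟨(s.sum, t.sum), Finset.HasAntidiagonal.mem_antidiagonal.2 (by omega)⟩,
        ⟨s, hs, rfl⟩, ⟨t, ht, rfl⟩⟩, rfl⟩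
  · have : {s | s ∈ V ∧ s.sum = n} = ∅ := by
      ext v
      simp only [Set.mem_ofPred_eq, Set.mem_empty_iff_false, iff_false]
      rintro ⟨hv, hvn⟩
      obtain ⟨⟨s, t⟩, ⟨hs, ht⟩, rfl⟩ := hf.surjOn hv
      have := hc s hs t ht
      omega
    simp [this]

theorem sumGenFun_eq_X_pow_mul {S V : Set (Multiset ℕ)} {f : Multiset ℕ → Multiset ℕ}
    {c : ℕ} (hf : Set.BijOn f S V) (hc : ∀ s ∈ S, (f s).sum = s.sum + c)
    (hS : ∀ n, {s | s ∈ S ∧ s.sum = n}.Finite) :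
    sumGenFun V = X ^ c * sumGenFun S := by
  rw [sumGenFun_eq_mul (S := S) (T := {0}) (f := fun x => f x.1) (c := c) ⟨?_, ?_, ?_⟩ ?_ hS ?_,
    sumGenFun_singleton_zero, mul_one]
  · exact fun x hx => hf.mapsTo hx.1
  · rintro ⟨s, t⟩ ⟨hs, rfl⟩ ⟨s', t'⟩ ⟨hs', rfl⟩ h
    exact Prod.ext (hf.injOn hs hs' h) rfl
  · intro v hv
    obtain ⟨s, hs, rfl⟩ := hf.surjOn hv
    exact ⟨(s, 0), ⟨hs, rfl⟩, rfl⟩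
  · rintro s hs t rfl
    simpa using hc s hs
  · exact fun n => (Set.finite_singleton 0).subset fun s hs => hs.1

/-- The multisets of positive integers. -/
def positiveMultisets : Set (Multiset ℕ) := {s | 0 ∉ s}

/-- Partitions of `n` are the multisets of positive integers with sum `n`. -/
def Nat.Partition.equivPositiveMultisets (n : ℕ) :
    Nat.Partition n ≃ {s | s ∈ positiveMultisets ∧ s.sum = n} where
  toFun π := ⟨π.parts, fun h => (π.parts_pos h).ne' rfl, π.parts_sum⟩
  invFun s := ⟨s.1, fun hi => Nat.pos_of_ne_zero fun h => s.2.1 (h ▸ hi), s.2.2⟩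
  left_inv _ := rfl
  right_inv _ := rfl

theorem finite_of_subset_positiveMultisets {S : Set (Multiset ℕ)} (hS : S ⊆ positiveMultisets)
    (n : ℕ) : {s | s ∈ S ∧ s.sum = n}.Finite :=
  have h : {s | s ∈ positiveMultisets ∧ s.sum = n}.Finite :=
    Finite.of_equiv _ (Nat.Partition.equivPositiveMultisets n)
  h.subset fun _ hs => ⟨hS hs.1, hs.2⟩

theorem coeff_sumGenFun_eq_card_filter {S : Set (Multiset ℕ)} (hS : S ⊆ positiveMultisets)
    (n : ℕ) [DecidablePred fun π : Nat.Partition n => π.parts ∈ S] :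
    coeff n (sumGenFun S) =
      ((Finset.univ.filter fun π : Nat.Partition n => π.parts ∈ S).card : ℤ) := by
  rw [coeff_sumGenFun, ← Set.ncard_coe_finset]
  congr 1
  symm
  refine Set.ncard_congr (fun π _ => π.parts) ?_ ?_ ?_
  · intro π hπ
    exact ⟨by simpa using hπ, π.parts_sum⟩
  · exact fun π π' _ _ h => Nat.Partition.ext h
  · rintro s ⟨hs, hn⟩
    refine ⟨(Nat.Partition.equivPositiveMultisets n).symm ⟨s, hS hs, hn⟩, ?_, rfl⟩
    simpa [Nat.Partition.equivPositiveMultisets] using hs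

/-! ### Bounded parts and bounded number of parts -/

/-- The multisets all of whose elements lie between `a` and `k`. -/
def boundedMultisets (a k : ℕ) : Set (Multiset ℕ) := {s | ∀ i ∈ s, a ≤ i ∧ i ≤ k}

theorem boundedMultisets_subset {a k : ℕ} (ha : 0 < a) :
    boundedMultisets a k ⊆ positiveMultisets :=
  fun _ hs h0 => ha.not_ge (hs 0 h0).1

theorem boundedMultisets_of_lt {a k : ℕ} (h : k < a) : boundedMultisets a k = {0} := by
  ext s
  simp only [boundedMultisets, Set.mem_ofPred_eq, Set.mem_singleton_iff]
  refine ⟨fun hs => Multiset.eq_zero_of_forall_notMem fun i hi => ?_, ?_⟩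
  · have := hs i hi
    omega
  · rintro rfl
    simp

/-- Split by whether `k + 1` occurs; if it does, remove one copy. -/
theorem sumGenFun_boundedMultisets_succ {a k : ℕ} (ha : 0 < a) (hk : a ≤ k + 1) :
    sumGenFun (boundedMultisets a (k + 1)) =
      sumGenFun (boundedMultisets a k) + X ^ (k + 1) * sumGenFun (boundedMultisets a (k + 1)) := by
  have hfin := finite_of_subset_positiveMultisets (boundedMultisets_subset (k := k + 1) ha)
  have himg := sumGenFun_eq_X_pow_mul (S := boundedMultisets a (k + 1)) (f := ((k + 1) ::ₘ ·))
    (c := k + 1) (V := {s | s ∈ boundedMultisets a (k + 1) ∧ k + 1 ∈ s}) ⟨?_, ?_, ?_⟩ ?_ hfin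
  · rw [← himg, ← sumGenFun_union]
    · congr 1
      ext s
      simp only [boundedMultisets, Set.mem_union, Set.mem_ofPred_eq]
      refine ⟨fun h => ?_, ?_⟩
      · by_cases hs : k + 1 ∈ s
        · exact Or.inr ⟨h, hs⟩
        · refine Or.inl fun i hi => ⟨(h i hi).1, Nat.le_of_lt_succ ((h i hi).2.lt_of_ne ?_)⟩
          rintro rfl
          exact hs hi
      · rintro (h | h)
        · exact fun i hi => ⟨(h i hi).1, (h i hi).2.trans (Nat.le_succ k)⟩
        · exact h.1
    · rw [Set.disjoint_left]
      intro s hs hs'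
      exact absurd (hs _ hs'.2).2 (by omega)
    · exact finite_of_subset_positiveMultisets (boundedMultisets_subset ha)
    · exact fun n => (hfin n).subset fun s hs => ⟨hs.1.1, hs.2⟩
  · intro s hs
    refine ⟨fun i hi => ?_, Multiset.mem_cons_self _ _⟩
    rcases Multiset.mem_cons.1 hi with rfl | hi
    · exact ⟨hk, le_rfl⟩
    · exact hs i hi
  · exact fun s _ t _ h => (Multiset.cons_inj_right _).1 h
  · rintro s ⟨hs, hk⟩
    exact ⟨s.erase (k + 1), fun i hi => hs i (Multiset.mem_of_mem_erase hi),
      Multiset.cons_erase hk⟩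
  · intro s _
    simp [add_comm]

/-- The generating function of partitions into parts of size at most `k`. -/
noncomputable def boundedGenFun (k : ℕ) : PowerSeries ℤ := sumGenFun (boundedMultisets 1 k)

theorem boundedGenFun_zero : boundedGenFun 0 = 1 := by
  rw [boundedGenFun, boundedMultisets_of_lt one_pos, sumGenFun_singleton_zero]

theorem one_sub_mul_boundedGenFun_succ (k : ℕ) :
    (1 - X ^ (k + 1)) * boundedGenFun (k + 1) = boundedGenFun k := by
  have := sumGenFun_boundedMultisets_succ (a := 1) (k := k) one_pos (by omega)
  unfold boundedGenFun
  linear_combination this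

theorem one_sub_X_pow_succ_ne_zero (k : ℕ) : (1 - X ^ (k + 1) : PowerSeries ℤ) ≠ 0 := by
  intro h
  have := congrArg (coeff 0) h
  simp at this

theorem sumGenFun_boundedMultisets_two (k : ℕ) :
    sumGenFun (boundedMultisets 2 (k + 1)) = (1 - X) * boundedGenFun (k + 1) := by
  induction k with
  | zero =>
    rw [boundedMultisets_of_lt (by norm_num), sumGenFun_singleton_zero]
    have := one_sub_mul_boundedGenFun_succ 0
    rw [boundedGenFun_zero] at this
    simpa using this.symm
  | succ k ih =>
    have h1 := sumGenFun_boundedMultisets_succ (a := 2) (k := k + 1) two_pos (by omega)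
    have h2 := one_sub_mul_boundedGenFun_succ (k + 1)
    apply mul_left_cancel₀ (one_sub_X_pow_succ_ne_zero (k + 1))
    linear_combination h1 + ih - (1 - X) * h2

/-- The multisets of natural numbers with exactly `k` elements. -/
def multisetsOfCard (k : ℕ) : Set (Multiset ℕ) := {s | s.card = k}

theorem Multiset.sum_map_add_const (s : Multiset ℕ) (c : ℕ) :
    (s.map (· + c)).sum = s.sum + s.card * c := by
  simp [Multiset.sum_map_add]

theorem Multiset.map_add_const_sub {s : Multiset ℕ} {c : ℕ} (h : ∀ i ∈ s, c ≤ i) :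
    (s.map (· - c)).map (· + c) = s := by
  rw [Multiset.map_map]
  conv_rhs => rw [← Multiset.map_id s]
  exact Multiset.map_congr rfl fun i hi => Nat.sub_add_cancel (h i hi)

theorem finite_multisetsOfCard (k n : ℕ) : {s | s ∈ multisetsOfCard k ∧ s.sum = n}.Finite := by
  -- Adding one to every element reduces to partitions of `n + k`.
  refine Set.Finite.of_finite_image (f := Multiset.map (· + 1)) ?_
    (Multiset.map_injective (add_left_injective 1)).injOn
  refine (finite_of_subset_positiveMultisets subset_rfl (n + k)).subset ?_
  rintro _ ⟨s, ⟨hs, rfl⟩, rfl⟩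
  refine ⟨?_, ?_⟩
  · simp [positiveMultisets]
  · rw [Multiset.sum_map_add_const, mul_one, hs]

/-- Either remove a zero or, if there is none, lower every element by one. -/
theorem sumGenFun_multisetsOfCard_succ (k : ℕ) :
    sumGenFun (multisetsOfCard (k + 1)) =
      sumGenFun (multisetsOfCard k) + X ^ (k + 1) * sumGenFun (multisetsOfCard (k + 1)) := by
  have himg := sumGenFun_eq_X_pow_mul (S := multisetsOfCard (k + 1)) (f := Multiset.map (· + 1))
    (c := k + 1) (V := {s | s ∈ multisetsOfCard (k + 1) ∧ 0 ∉ s}) ⟨?_, ?_, ?_⟩ ?_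
    (finite_multisetsOfCard _)
  · have himg' := sumGenFun_eq_X_pow_mul (S := multisetsOfCard k) (f := (0 ::ₘ ·))
      (c := 0) (V := {s | s ∈ multisetsOfCard (k + 1) ∧ 0 ∈ s}) ⟨?_, ?_, ?_⟩ ?_
      (finite_multisetsOfCard _)
    · rw [pow_zero, one_mul] at himg'
      rw [← himg, ← himg', ← sumGenFun_union]
      · congr 1
        ext s
        simp only [Set.mem_union, Set.mem_ofPred_eq]
        tauto
      · rw [Set.disjoint_left]
        exact fun s hs hs' => hs'.2 hs.2
      · exact fun n => (finite_multisetsOfCard _ n).subset fun s hs => ⟨hs.1.1, hs.2⟩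
      · exact fun n => (finite_multisetsOfCard _ n).subset fun s hs => ⟨hs.1.1, hs.2⟩
    · intro s hs
      have hs : s.card = k := hs
      simp [multisetsOfCard, hs]
    · exact fun s _ t _ h => (Multiset.cons_inj_right _).1 h
    · rintro s ⟨hs, h0⟩
      have hs : s.card = k + 1 := hs
      refine ⟨s.erase 0, ?_, Multiset.cons_erase h0⟩
      simp [multisetsOfCard, Multiset.card_erase_of_mem h0, hs]
    · simp
  · intro s hs
    have hs : s.card = k + 1 := hs
    simp [multisetsOfCard, hs]
  · exact (Multiset.map_injective (add_left_injective 1)).injOn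
  · rintro s ⟨hs, h0⟩
    have hs : s.card = k + 1 := hs
    refine ⟨s.map (· - 1), by simp [multisetsOfCard, hs], Multiset.map_add_const_sub fun i hi => ?_⟩
    exact Nat.pos_of_ne_zero fun h => h0 (h ▸ hi)
  · intro s hs
    have hs : s.card = k + 1 := hs
    rw [Multiset.sum_map_add_const, hs, mul_one]

/-- Both sides satisfy the same recurrence, which replaces conjugation of Ferrers diagrams. -/
theorem sumGenFun_multisetsOfCard (k : ℕ) :
    sumGenFun (multisetsOfCard k) = boundedGenFun k := by
  induction k with
  | zero =>
    rw [boundedGenFun_zero, ← sumGenFun_singleton_zero]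
    congr 1
    ext s
    simp [multisetsOfCard]
  | succ k ih =>
    apply mul_left_cancel₀ (one_sub_X_pow_succ_ne_zero k)
    rw [one_sub_mul_boundedGenFun_succ, ← ih]
    linear_combination sumGenFun_multisetsOfCard_succ k

/-! ### Partitions with prescribed crank data -/

/-- The multisets of positive integers with exactly `w` ones and exactly `m` elements above `w`. -/
def crankClass (w m : ℕ) : Set (Multiset ℕ) :=
  {s | 0 ∉ s ∧ s.count 1 = w ∧ s.countP (w < ·) = m}

/-- Cut the multiset into its `w + 1` ones, its elements in `[2, w + 1]`, and its `m` larger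
elements, each lowered by `w + 2`. -/
theorem sumGenFun_crankClass (w m : ℕ) :
    sumGenFun (crankClass (w + 1) m) =
      X ^ ((w + 1) + (w + 2) * m) * ((1 - X) * boundedGenFun (w + 1) * boundedGenFun m) := by
  rw [← sumGenFun_boundedMultisets_two, ← sumGenFun_multisetsOfCard]
  have hlow : ∀ s ∈ boundedMultisets 2 (w + 1), ∀ t ∈ multisetsOfCard m,
      (Multiset.replicate (w + 1) 1 + s + t.map (· + (w + 2))).filter
        (fun i => 2 ≤ i ∧ i ≤ w + 1) = s := by
    intro s hs t _
    rw [Multiset.filter_add, Multiset.filter_add, Multiset.filter_eq_self.2 hs,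
      Multiset.filter_eq_nil.2, Multiset.filter_eq_nil.2]
    · simp
    · simp only [Multiset.mem_map]
      rintro _ ⟨i, _, rfl⟩
      omega
    · intro i hi
      rw [Multiset.eq_of_mem_replicate hi]
      omega
  have hhigh : ∀ s ∈ boundedMultisets 2 (w + 1), ∀ t ∈ multisetsOfCard m,
      (Multiset.replicate (w + 1) 1 + s + t.map (· + (w + 2))).filter
        (fun i => w + 1 < i) = t.map (· + (w + 2)) := by
    intro s hs t _
    rw [Multiset.filter_add, Multiset.filter_add, Multiset.filter_eq_nil.2,
      Multiset.filter_eq_nil.2, Multiset.filter_eq_self.2]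
    · simp
    · simp only [Multiset.mem_map]
      rintro _ ⟨i, _, rfl⟩
      omega
    · intro i hi
      have := hs i hi
      omega
    · intro i hi
      rw [Multiset.eq_of_mem_replicate hi]
      omega
  refine sumGenFun_eq_mul
    (f := fun x => Multiset.replicate (w + 1) 1 + x.1 + x.2.map (· + (w + 2)))
    ⟨?_, ?_, ?_⟩ ?_ (finite_of_subset_positiveMultisets (boundedMultisets_subset two_pos))
    (finite_multisetsOfCard m)
  · rintro ⟨s, t⟩ ⟨hs, ht⟩
    refine ⟨?_, ?_, ?_⟩
    · have : 0 ∉ s := fun h => absurd (hs 0 h).1 (by omega)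
      simp [Multiset.mem_replicate, this]
    · have : s.count 1 = 0 := Multiset.count_eq_zero.2 fun h => absurd (hs 1 h).1 (by omega)
      simp only [Multiset.count_add, Multiset.count_replicate_self, this, add_zero,
        Nat.add_eq_left, Multiset.count_eq_zero, Multiset.mem_map, not_exists, not_and]
      omega
    · rw [Multiset.countP_eq_card_filter, hhigh s hs t ht, Multiset.card_map]
      exact ht
  · rintro ⟨s, t⟩ ⟨hs, ht⟩ ⟨s', t'⟩ ⟨hs', ht'⟩ h
    simp only at h
    refine Prod.ext ?_ ?_
    · have h' := congrArg (Multiset.filter (fun i => 2 ≤ i ∧ i ≤ w + 1)) h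
      rwa [hlow s hs t ht, hlow s' hs' t' ht'] at h'
    · have h' := congrArg (Multiset.filter (fun i => w + 1 < i)) h
      rw [hhigh s hs t ht, hhigh s' hs' t' ht'] at h'
      exact Multiset.map_injective (add_left_injective (w + 2)) h'
  · rintro s ⟨h0, h1, hm⟩
    refine ⟨(s.filter (fun i => 2 ≤ i ∧ i ≤ w + 1),
      (s.filter (fun i => w + 1 < i)).map (· - (w + 2))), ⟨?_, ?_⟩, ?_⟩
    · exact fun i hi => (Multiset.mem_filter.1 hi).2
    · rw [Multiset.countP_eq_card_filter] at hm
      simp [multisetsOfCard, hm]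
    · simp only
      rw [Multiset.map_add_const_sub (s := s.filter (fun i => w + 1 < i)) (c := w + 2)
        fun i hi => (Multiset.mem_filter.1 hi).2]
      ext i
      simp only [Multiset.count_add, Multiset.count_replicate, Multiset.count_filter]
      rcases Nat.eq_zero_or_pos i with rfl | hi
      · simp [Multiset.count_eq_zero.2 h0]
      · by_cases hi1 : i = 1
        · subst hi1
          simp [h1]
        · split_ifs <;> omega
  · intro s _ t ht
    have ht : t.card = m := ht
    simp only [Multiset.sum_add, Multiset.sum_replicate, Multiset.sum_map_add_const, ht,
      smul_eq_mul, mul_one]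
    ring

theorem coeff_boundedGenFun_nonneg (k n : ℕ) : 0 ≤ coeff n (boundedGenFun k) := by
  rw [boundedGenFun, coeff_sumGenFun]
  exact Nat.cast_nonneg _

theorem coeff_boundedGenFun_pos {k : ℕ} (hk : 1 ≤ k) (n : ℕ) : 0 < coeff n (boundedGenFun k) := by
  rw [boundedGenFun, coeff_sumGenFun, Nat.cast_pos, Set.ncard_pos
    (finite_of_subset_positiveMultisets (boundedMultisets_subset one_pos) n)]
  refine ⟨Multiset.replicate n 1, fun i hi => ?_, by simp⟩
  rw [Multiset.eq_of_mem_replicate hi]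
  exact ⟨le_rfl, hk⟩

theorem X_pow_dvd_sumGenFun_positiveMultisets_sub (k : ℕ) :
    X ^ k ∣ sumGenFun positiveMultisets - boundedGenFun k := by
  rw [X_pow_dvd_iff]
  intro n hn
  rw [map_sub, boundedGenFun, coeff_sumGenFun, coeff_sumGenFun, sub_eq_zero]
  congr 2
  ext s
  simp only [Set.mem_ofPred_eq]
  refine and_congr_left fun hs => ⟨fun h i hi => ⟨?_, ?_⟩, fun h => ?_⟩
  · exact Nat.pos_of_ne_zero fun h0 => h (h0 ▸ hi)
  · exact (Multiset.le_sum_of_mem hi).trans (hs.trans_le hn.le)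
  · exact boundedMultisets_subset one_pos h

/-! ### Durfee sums -/

/-- The summand `X ^ (μ (μ + m) + a μ) / ((X; X)_μ (X; X)_{μ + m})`, in which the exponent at
`a = 0` is the area of a Durfee rectangle. -/
noncomputable def durfeeTerm (a m μ : ℕ) : PowerSeries ℤ :=
  X ^ (μ * (μ + m) + a * μ) * (boundedGenFun μ * boundedGenFun (μ + m))

/-- The partial sums of `durfeeTerm`. -/
noncomputable def durfeeSum (a m M : ℕ) : PowerSeries ℤ :=
  ∑ μ ∈ Finset.range M, durfeeTerm a m μ

theorem X_pow_dvd_durfeeTerm (a m μ : ℕ) : X ^ μ ∣ durfeeTerm a m μ :=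
  Dvd.dvd.mul_right (pow_dvd_pow X (by
    nlinarith [Nat.zero_le (μ * m), Nat.le_mul_self μ, Nat.zero_le (a * μ)])) _

/-- The difference puts a factor `1 - X ^ μ` in each term, which kills `μ = 0` and otherwise lowers
`boundedGenFun μ` to index `μ - 1`; then shift `μ`. -/
theorem durfeeSum_sub_durfeeSum_succ_left (a m M : ℕ) :
    durfeeSum a m (M + 1) - durfeeSum (a + 1) m (M + 1) =
      X ^ (a + m + 1) * durfeeSum (a + 1) (m + 1) M := by
  unfold durfeeSum
  rw [← Finset.sum_sub_distrib, Finset.sum_range_succ', Finset.mul_sum]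
  simp only [durfeeTerm, zero_mul, mul_zero, sub_self, add_zero]
  refine Finset.sum_congr rfl fun μ _ => ?_
  rw [← one_sub_mul_boundedGenFun_succ μ, show μ + 1 + m = μ + (m + 1) by ring]
  ring

/-- Here the factor `1 - X ^ (μ + m + 1)` lowers the second `boundedGenFun`. -/
theorem durfeeSum_succ_sub (a m M : ℕ) :
    durfeeSum a (m + 1) M - X ^ (m + 1) * durfeeSum (a + 1) (m + 1) M =
      durfeeSum (a + 1) m M := by
  unfold durfeeSum
  rw [Finset.mul_sum, ← Finset.sum_sub_distrib]
  refine Finset.sum_congr rfl fun μ _ => ?_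
  simp only [durfeeTerm]
  rw [← one_sub_mul_boundedGenFun_succ (μ + m), show μ + (m + 1) = μ + m + 1 by ring]
  ring

theorem X_pow_dvd_durfeeSum_succ_sub (a m M : ℕ) :
    X ^ M ∣ durfeeSum a m (M + 1) - durfeeSum a m M := by
  rw [durfeeSum, durfeeSum, Finset.sum_range_succ, add_sub_cancel_left]
  exact X_pow_dvd_durfeeTerm a m M

theorem X_pow_dvd_durfeeSum_zero_sub_succ (m M : ℕ) :
    X ^ M ∣ durfeeSum 0 m M - durfeeSum 0 (m + 1) M := by
  have h1 := durfeeSum_sub_durfeeSum_succ_left 0 m M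
  have h2 := durfeeSum_succ_sub 0 m M
  rw [zero_add] at h1 h2
  convert (X_pow_dvd_durfeeSum_succ_sub 1 m M).sub (X_pow_dvd_durfeeSum_succ_sub 0 m M) using 1
  linear_combination h1 - h2

/-- With `m = M`, every term with `μ ≥ 1` has exponent at least `M`. -/
theorem X_pow_dvd_durfeeSum_sub_boundedGenFun (a M : ℕ) :
    X ^ M ∣ durfeeSum a M M - boundedGenFun M := by
  rcases M with _ | M
  · simp
  · rw [durfeeSum, Finset.sum_range_succ', add_sub_assoc]
    refine dvd_add (Finset.dvd_sum fun μ _ => ?_) ?_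
    · exact Dvd.dvd.mul_right (pow_dvd_pow X (by
        nlinarith [Nat.zero_le (a * (μ + 1)), Nat.zero_le (μ * (μ + 1 + (M + 1)))])) _
    · simp [durfeeTerm, boundedGenFun_zero]

/-- The Durfee rectangle identity, modulo `X ^ M`. -/
theorem X_pow_dvd_durfeeSum_zero_sub (m M : ℕ) :
    X ^ M ∣ durfeeSum 0 m M - sumGenFun positiveMultisets := by
  have hconst : ∀ d, X ^ M ∣ durfeeSum 0 m M - durfeeSum 0 (m + d) M := by
    intro d
    induction d with
    | zero => simp
    | succ d ih =>
      convert ih.add (X_pow_dvd_durfeeSum_zero_sub_succ (m + d) M) using 1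
      rw [add_assoc]
      ring
  -- Both `m` and `M` are compared with `0`, since either may be the larger.
  have hzero : ∀ d, X ^ M ∣ durfeeSum 0 0 M - durfeeSum 0 d M := by
    intro d
    induction d with
    | zero => simp
    | succ d ih =>
      convert ih.add (X_pow_dvd_durfeeSum_zero_sub_succ d M) using 1
      ring
  convert (((hzero M).sub (hzero m)).add (X_pow_dvd_durfeeSum_sub_boundedGenFun 0 M)).sub
    (X_pow_dvd_sumGenFun_positiveMultisets_sub M) using 1
  ring

theorem X_pow_dvd_durfeeSum_one_add (m M : ℕ) :
    X ^ M ∣ durfeeSum 1 m M + X ^ (m + 1) * durfeeSum 1 (m + 1) M -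
      sumGenFun positiveMultisets := by
  have h1 := durfeeSum_sub_durfeeSum_succ_left 0 m M
  rw [zero_add, zero_add] at h1
  convert ((X_pow_dvd_durfeeSum_succ_sub 0 m M).sub (X_pow_dvd_durfeeSum_succ_sub 1 m M)).add
    (X_pow_dvd_durfeeSum_zero_sub m M) using 1
  linear_combination -h1

theorem X_pow_dvd_sum_triangular_sub (k M : ℕ) :
    X ^ M ∣ ∑ j ∈ Finset.range k,
        (-1) ^ j * (X ^ (j * (j + 1) / 2) * sumGenFun positiveMultisets) +
      (-1) ^ k * (X ^ (k * (k + 1) / 2) * durfeeSum 1 k M) - durfeeSum 1 0 M := by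
  induction k with
  | zero => simp
  | succ k ih =>
    have ht : (k + 1) * (k + 1 + 1) / 2 = k * (k + 1) / 2 + (k + 1) := by
      rw [← Nat.add_mul_div_left _ _ two_pos]
      congr 1
      ring
    convert ih.sub ((X_pow_dvd_durfeeSum_one_add k M).mul_left
      ((-1) ^ k * X ^ (k * (k + 1) / 2))) using 1
    rw [Finset.sum_range_succ, ht]
    ring

/-- The term `μ = 0`, present since `M ≥ 1`, is `boundedGenFun m`, already positive in every degree.
-/
theorem coeff_durfeeSum_pos {a m M : ℕ} (hm : 1 ≤ m) (hM : 1 ≤ M) (n : ℕ) :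
    0 < coeff n (durfeeSum a m M) := by
  obtain ⟨M, rfl⟩ := Nat.exists_eq_add_of_le' hM
  rw [durfeeSum, Finset.sum_range_succ', map_add, map_sum]
  refine add_pos_of_nonneg_of_pos (Finset.sum_nonneg fun μ _ => ?_) ?_
  · rw [durfeeTerm, coeff_X_pow_mul']
    split_ifs
    · rw [coeff_mul]
      exact Finset.sum_nonneg fun x _ =>
        mul_nonneg (coeff_boundedGenFun_nonneg _ _) (coeff_boundedGenFun_nonneg _ _)
    · exact le_rfl
  · simpa [durfeeTerm, boundedGenFun_zero] using coeff_boundedGenFun_pos hm n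

/-! ### Telescoping the negative cranks -/

theorem sum_sumGenFun_crankClass (w : ℕ) :
    ∑ m ∈ Finset.range (w + 1), sumGenFun (crankClass (w + 1) m) =
      boundedGenFun (w + 1) - boundedGenFun w - durfeeTerm 1 0 (w + 1)
        + ∑ μ ∈ Finset.range (w + 1), X ^ ((w + 3) * (μ + 1)) *
          (boundedGenFun (μ + 1) * boundedGenFun (w + 1))
        - ∑ μ ∈ Finset.range w, X ^ ((w + 2) * (μ + 1)) *
          (boundedGenFun (μ + 1) * boundedGenFun w) := by
  -- The first bracket telescopes in `m`; the second, after summation over `m`, telescopes in `w`.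
  have hterm : ∀ m, sumGenFun (crankClass (w + 1) m) =
      (X ^ ((w + 2) * m) * (boundedGenFun m * boundedGenFun (w + 1)) -
        X ^ ((w + 2) * (m + 1)) * (boundedGenFun (m + 1) * boundedGenFun (w + 1))) +
      (X ^ ((w + 3) * (m + 1)) * (boundedGenFun (m + 1) * boundedGenFun (w + 1)) -
        X ^ ((w + 2) * m) * (boundedGenFun m * boundedGenFun w)) := by
    intro m
    rw [sumGenFun_crankClass, ← one_sub_mul_boundedGenFun_succ w,
      ← one_sub_mul_boundedGenFun_succ m]
    ring
  simp only [hterm]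
  rw [Finset.sum_add_distrib, Finset.sum_range_sub', Finset.sum_sub_distrib,
    Finset.sum_range_succ' (fun m => X ^ ((w + 2) * m) * (boundedGenFun m * boundedGenFun w))]
  simp only [durfeeTerm, mul_zero, pow_zero, boundedGenFun_zero]
  ring

theorem sum_sum_sumGenFun_crankClass (M : ℕ) :
    ∑ w ∈ Finset.range M, ∑ m ∈ Finset.range (w + 1), sumGenFun (crankClass (w + 1) m) =
      boundedGenFun M - durfeeSum 1 0 (M + 1)
        + ∑ μ ∈ Finset.range M, X ^ ((M + 2) * (μ + 1)) *
          (boundedGenFun (μ + 1) * boundedGenFun M) := by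
  induction M with
  | zero => simp [durfeeSum, durfeeTerm, boundedGenFun_zero]
  | succ M ih =>
    rw [Finset.sum_range_succ, ih, sum_sumGenFun_crankClass, durfeeSum, durfeeSum,
      Finset.sum_range_succ _ (M + 1)]
    ring

theorem X_pow_dvd_sum_sumGenFun_crankClass_sub (M : ℕ) :
    X ^ M ∣ ∑ w ∈ Finset.range M, ∑ m ∈ Finset.range (w + 1), sumGenFun (crankClass (w + 1) m) -
      (sumGenFun positiveMultisets - durfeeSum 1 0 M) := by
  have hrest : X ^ M ∣ ∑ μ ∈ Finset.range M, X ^ ((M + 2) * (μ + 1)) *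
      (boundedGenFun (μ + 1) * boundedGenFun M) :=
    Finset.dvd_sum fun μ _ => Dvd.dvd.mul_right (pow_dvd_pow X (by
      nlinarith [Nat.zero_le (M * μ)])) _
  rw [sum_sum_sumGenFun_crankClass]
  convert (hrest.sub (X_pow_dvd_durfeeSum_succ_sub 1 0 M)).sub
    (X_pow_dvd_sumGenFun_positiveMultisets_sub M) using 1
  ring

/-! ### Return to partition counts -/

theorem coeff_sumGenFun_positiveMultisets (n : ℕ) :
    coeff n (sumGenFun positiveMultisets) = (Fintype.card (Nat.Partition n) : ℤ) := by
  classical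
  rw [coeff_sumGenFun_eq_card_filter subset_rfl, Finset.filter_true_of_mem, Finset.card_univ]
  exact fun π _ h0 => (π.parts_pos h0).ne' rfl

theorem coeff_X_pow_mul_sumGenFun_positiveMultisets (t n : ℕ) :
    coeff n (X ^ t * sumGenFun positiveMultisets) = (partitionFunction ((n : ℤ) - t) : ℤ) := by
  rw [coeff_X_pow_mul', partitionFunction]
  by_cases h : t ≤ n
  · rw [if_pos h, if_pos (by omega), coeff_sumGenFun_positiveMultisets, ← Nat.cast_sub h,
      Int.toNat_natCast]
  · rw [if_neg h, if_neg (by omega), Nat.cast_zero]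

/-- Without ones the crank is non-negative and the right side fails too, so one criterion covers
both cases. -/
theorem Nat.Partition.crank_neg_iff {n : ℕ} (π : Nat.Partition n) :
    π.crank < 0 ↔ π.numPartsGtOnes < π.numOnes := by
  unfold crank
  split_ifs with h <;> omega

theorem Nat.Partition.numOnes_le {n : ℕ} (π : Nat.Partition n) : π.numOnes ≤ n := by
  have h : Multiset.replicate π.numOnes 1 ≤ π.parts := Multiset.le_count_iff_replicate_le.1 le_rfl
  obtain ⟨u, hu⟩ := Multiset.le_iff_exists_add.1 h
  have hsum := congrArg Multiset.sum hu
  rw [π.parts_sum, Multiset.sum_add, Multiset.sum_replicate, smul_eq_mul, mul_one] at hsum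
  omega

theorem crankClass_subset (w m : ℕ) : crankClass w m ⊆ positiveMultisets := fun _ hs => hs.1

theorem card_crank_neg (n : ℕ) :
    ((Finset.univ.filter fun π : Nat.Partition n => π.crank < 0).card : ℤ) =
      coeff n (∑ w ∈ Finset.range (n + 1), ∑ m ∈ Finset.range (w + 1),
        sumGenFun (crankClass (w + 1) m)) := by
  classical
  simp only [map_sum, coeff_sumGenFun_eq_card_filter (crankClass_subset _ _)]
  -- Negative crank forces at least one 1, so the truncated `numOnes - 1` loses nothing.
  rw [Finset.sum_sigma', Finset.card_eq_sum_card_fiberwise (f := fun π : Nat.Partition n =>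
    (⟨π.numOnes - 1, π.numPartsGtOnes⟩ : Σ _ : ℕ, ℕ))
    (t := (Finset.range (n + 1)).sigma fun w => Finset.range (w + 1)), Nat.cast_sum]
  · refine Finset.sum_congr rfl ?_
    rintro ⟨w, m⟩ hwm
    simp only [Finset.mem_sigma, Finset.mem_range] at hwm
    congr 2
    ext π
    have h0 : 0 ∉ π.parts := fun h0 => (π.parts_pos h0).ne' rfl
    simp only [Finset.mem_filter, Finset.mem_univ, true_and, π.crank_neg_iff, Sigma.mk.injEq,
      heq_eq_eq, crankClass, Set.mem_ofPred_eq, h0, not_false_eq_true]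
    have hw : π.parts.count 1 = π.numOnes := rfl
    rw [hw]
    constructor
    · rintro ⟨h1, h2, h3⟩
      have h4 : π.numOnes = w + 1 := by omega
      refine ⟨h4, ?_⟩
      rw [← h4, ← h3]
      rfl
    · rintro ⟨h1, h2⟩
      rw [← h1] at h2
      have h3 : π.numPartsGtOnes = m := h2
      omega
  · intro π hπ
    simp only [Finset.coe_filter, Finset.mem_univ, true_and, Set.mem_ofPred_eq,
      π.crank_neg_iff] at hπ
    have := π.numOnes_le
    simp only [Finset.coe_sigma, Set.mem_sigma_iff, Finset.coe_range, Set.mem_Iio]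
    omega

theorem nonnegCrankCount_eq_coeff (n : ℕ) :
    (nonnegCrankCount n : ℤ) = coeff n (durfeeSum 1 0 (n + 1)) := by
  have h := X_pow_dvd_iff.1 (X_pow_dvd_sum_sumGenFun_crankClass_sub (n + 1)) n n.lt_succ_self
  rw [map_sub, map_sub, ← card_crank_neg, coeff_sumGenFun_positiveMultisets] at h
  have h' := Finset.card_filter_add_card_filter_not (s := (Finset.univ : Finset (Nat.Partition n)))
    (fun π : Nat.Partition n => π.crank < 0)
  simp only [not_lt] at h'
  rw [Finset.card_univ] at h'
  rw [nonnegCrankCount, Fintype.card_subtype]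
  zify at h'
  linarith

theorem alternating_sum_sub_nonnegCrankCount (n k : ℕ) (hk : 1 ≤ k) :
    (-1 : ℤ) ^ (k - 1) *
        ((∑ j ∈ Finset.range k,
            (-1 : ℤ) ^ j * (partitionFunction ((n : ℤ) - ((j * (j + 1) / 2 : ℕ) : ℤ)) : ℤ))
          - (nonnegCrankCount n : ℤ)) =
      coeff n (X ^ (k * (k + 1) / 2) * durfeeSum 1 k (n + 1)) := by
  obtain ⟨k, rfl⟩ := Nat.exists_eq_add_of_le' hk
  have h := X_pow_dvd_iff.1 (X_pow_dvd_sum_triangular_sub (k + 1) (n + 1)) n n.lt_succ_self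
  have hC : ∀ (j : ℕ) (f : PowerSeries ℤ), coeff n ((-1) ^ j * f) = (-1) ^ j * coeff n f := by
    intro j f
    rcases Nat.even_or_odd j with hj | hj <;> simp [hj.neg_one_pow]
  simp only [map_sub, map_add, map_sum, hC, coeff_X_pow_mul_sumGenFun_positiveMultisets] at h
  rw [← nonnegCrankCount_eq_coeff] at h
  rw [Nat.add_sub_cancel]
  have hsq : (-1 : ℤ) ^ k * (-1) ^ k = 1 := by rw [← mul_pow]; simp
  rw [pow_succ (-1 : ℤ) k] at h
  linear_combination (-1) ^ k * h +
    hsq * coeff n (X ^ ((k + 1) * (k + 1 + 1) / 2) * durfeeSum 1 (k + 1) (n + 1))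

theorem mainTheorem4 (n k : ℕ) (hk : 1 ≤ k) :
    0 ≤ (-1 : ℤ) ^ (k - 1) *
        ((∑ j ∈ Finset.range k,
            (-1 : ℤ) ^ j * (partitionFunction ((n : ℤ) - ((j * (j + 1) / 2 : ℕ) : ℤ)) : ℤ))
          - (nonnegCrankCount n : ℤ)) ∧
    (k * (k + 1) / 2 ≤ n →
      0 < (-1 : ℤ) ^ (k - 1) *
        ((∑ j ∈ Finset.range k,
            (-1 : ℤ) ^ j * (partitionFunction ((n : ℤ) - ((j * (j + 1) / 2 : ℕ) : ℤ)) : ℤ))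
          - (nonnegCrankCount n : ℤ))) := by
  rw [alternating_sum_sub_nonnegCrankCount n k hk, coeff_X_pow_mul']
  split_ifs with h
  · exact ⟨(coeff_durfeeSum_pos hk n.succ_pos _).le, fun _ =>
      coeff_durfeeSum_pos hk n.succ_pos _⟩
  · exact ⟨le_rfl, fun h' => absurd h' h⟩
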